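/- Let $K=\mathrm{GF}(q)$ be a finite field and let $\sigma$ be an automorphism of $K$ with $\sigma\neq\mathrm{id}$. Let $R=K(\varepsilon;\sigma)=K+K\varepsilon$ be the ring of twisted dual numbers, with multiplication $(a+b\varepsilon)(c+d\varepsilon)=ac+(ad+bc^{\sigma})\varepsilon$. The projective line $\mathbb P(R)$ is the set of all left submodules $R(a,b)\le R^2$ such that $(a,b)$ is the first row of a matrix in $\mathrm{GL}_2(R)$; the group $\mathrm{GL}_2(R)$ acts on $\mathbb P(R)$ by right multiplication. The base block is $B_0=\mathbb P(K)=\{R(x,1)\mid x\in K\}\cup\{R(1,0)\}\subseteq\mathbb P(R)$, and the blocks of $\Sigma$ are the images of $B_0$ under the elements of $\mathrm{GL}_2(R)$. Embed $R$ in the ring $M$ of $2\times 2$-matrices over $K$ via $a+b\varepsilon\mapsto\begin{pmatrix}a&b\\0&a^{\sigma}\end{pmatrix}$, so that each point $R(a,b)$ of $\mathbb P(R)$ yields the point $M(a,b)$ of $\mathbb P(M)$. Let $\mathcal K$ be the Klein quadric in $\mathrm{PG}(5,K)$, the projective space on $M\times K\times K$, given by the quadratic form $(C,x,y)\mapsto\det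 C-xy$, and let $\Phi$ be Hotje's map $M(A,B)\mapsto K(\widetilde BA,\det A,\det B)$ from $\mathbb P(M)$ to the points of $\mathcal K$, where $\widetilde B$ is the adjugate of $B$. Let $S\in\mathcal K$ be the point spanned by $\left(\begin{pmatrix}0&1\\0&0\end{pmatrix},0,0\right)$, let $\boldsymbol H$ be the tangent hyperplane to $\mathcal K$ at $S$, and let $\mathcal C$ be the cone with vertex $S$ over $\Phi(B_0)$, i.e. the union of all lines joining $S$ with the points of $\Phi(B_0)$ (the point $S$ is not in $\Phi(B_0)$). Then $\Phi$ maps $\mathbb P(R)$ injectively into $\mathcal K$; $\boldsymbol H$ is a $\mathrm{PG}(4,q)$, $\mathcal C\subseteq\boldsymbol H$, and $\Phi(\mathbb P(R))=\mathcal C\setminus\{S\}$. The sets $\Phi(B)$, with $B$ a block of $\Sigma$, are exactly the intersections of $\mathcal C$ with the $3$-spaces of $\boldsymbol H$ complementary to $S$. -/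

import Mathlib

open scoped LinearAlgebra.Projectivization

/-! ### The projective line over a (not necessarily commutative) ring -/

/-- The group `GL₂(R)` of invertible `2 × 2`-matrices over a ring `R`. -/
abbrev GLTwo (R : Type*) [Ring R] : Type _ := (Matrix (Fin 2) (Fin 2) R)ˣ

/-- The projective line `ℙ(R)`: the cyclic left submodules `R(a,b)` of `R²` such that `(a,b)` is
the first row of a matrix in `GL₂(R)`. -/
def ProjLine (R : Type*) [Ring R] : Type _ :=
  {p : Submodule R (Fin 2 → R) // ∃ g : GLTwo R, p = Submodule.span R {g.val.row 0}}

namespace ProjLine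

/-- The action of `GL₂(R)` on `ℙ(R)`, induced by `(a,b) ↦ (a,b) ⬝ g`. -/
def act {R : Type*} [Ring R] (g : GLTwo R) (p : ProjLine R) : ProjLine R :=
  ⟨p.1.map (Matrix.vecMulLinear g.val), by
    obtain ⟨h, hh⟩ := p.2
    refine ⟨h * g, ?_⟩
    rw [hh, Submodule.map_span, Set.image_singleton]
    rfl⟩

/-- The map `ℙ(A) → ℙ(B)`, `A(a,b) ↦ B(f a, f b)` induced by a ring homomorphism `f : A → B`. -/
def map {A B : Type*} [Ring A] [Ring B] (f : A →+* B) (p : ProjLine A) : ProjLine B :=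
  ⟨Submodule.span B ((fun v : Fin 2 → A => f ∘ v) '' (p.1 : Set (Fin 2 → A))), by
    obtain ⟨h, hh⟩ := p.2
    refine ⟨Units.map (f.mapMatrix : Matrix (Fin 2) (Fin 2) A →+* _).toMonoidHom h, ?_⟩
    have hrow : (Units.map (f.mapMatrix : Matrix (Fin 2) (Fin 2) A →+* _).toMonoidHom h).val.row 0
        = f ∘ h.val.row 0 := rfl
    rw [hrow, hh]
    apply le_antisymm
    · rw [Submodule.span_le]
      rintro _ ⟨v, hv, rfl⟩
      obtain ⟨r, rfl⟩ := Submodule.mem_span_singleton.1 hv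
      refine Submodule.mem_span_singleton.2 ⟨f r, ?_⟩
      ext i
      simp
    · rw [Submodule.span_singleton_le_iff_mem]
      exact Submodule.subset_span ⟨h.val.row 0, Submodule.mem_span_singleton_self _, rfl⟩⟩

end ProjLine

/-! ### Twisted dual numbers -/

/-- The twisted dual numbers `K(ε;σ) = K + Kε`; the element `a + bε` is `⟨a, b⟩`. -/
@[ext]
structure TwistedDual {K : Type*} [Field K] (σ : K →+* K) where
  re : K
  eps : K

namespace TwistedDual

variable {K : Type*} [Field K] {σ : K →+* K}

instance : Zero (TwistedDual σ) := ⟨⟨0, 0⟩⟩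
instance : One (TwistedDual σ) := ⟨⟨1, 0⟩⟩
instance : Add (TwistedDual σ) := ⟨fun x y => ⟨x.re + y.re, x.eps + y.eps⟩⟩
instance : Neg (TwistedDual σ) := ⟨fun x => ⟨-x.re, -x.eps⟩⟩

/-- `(a + bε)(c + dε) = ac + (ad + b c^σ)ε`. -/
instance : Mul (TwistedDual σ) :=
  ⟨fun x y => ⟨x.re * y.re, x.re * y.eps + x.eps * σ y.re⟩⟩

@[simp] theorem zero_re : (0 : TwistedDual σ).re = 0 := rfl
@[simp] theorem zero_eps : (0 : TwistedDual σ).eps = 0 := rfl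
@[simp] theorem one_re : (1 : TwistedDual σ).re = 1 := rfl
@[simp] theorem one_eps : (1 : TwistedDual σ).eps = 0 := rfl
@[simp] theorem add_re (x y : TwistedDual σ) : (x + y).re = x.re + y.re := rfl
@[simp] theorem add_eps (x y : TwistedDual σ) : (x + y).eps = x.eps + y.eps := rfl
@[simp] theorem neg_re (x : TwistedDual σ) : (-x).re = -x.re := rfl
@[simp] theorem neg_eps (x : TwistedDual σ) : (-x).eps = -x.eps := rfl
@[simp] theorem mul_re (x y : TwistedDual σ) : (x * y).re = x.re * y.re := rfl
@[simp] theorem mul_eps (x y : TwistedDual σ) :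
    (x * y).eps = x.re * y.eps + x.eps * σ y.re := rfl

instance : Ring (TwistedDual σ) where
  add_assoc x y z := by ext <;> simp [add_assoc]
  zero_add x := by ext <;> simp
  add_zero x := by ext <;> simp
  add_comm x y := by ext <;> simp [add_comm]
  neg_add_cancel x := by ext <;> simp
  left_distrib x y z := by ext <;> simp <;> ring
  right_distrib x y z := by ext <;> simp <;> ring
  zero_mul x := by ext <;> simp
  mul_zero x := by ext <;> simp
  mul_assoc x y z := by ext <;> simp <;> ring
  one_mul x := by ext <;> simp
  mul_one x := by ext <;> simp
  nsmul := nsmulRec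
  zsmul := zsmulRec

variable (σ)

/-- The inclusion of the subfield `K` in `K(ε;σ)`. -/
def ofBase : K →+* TwistedDual σ where
  toFun a := ⟨a, 0⟩
  map_zero' := rfl
  map_one' := rfl
  map_add' a b := by ext <;> simp
  map_mul' a b := by ext <;> simp

/-- The embedding of `K(ε;σ)` in the ring of `2 × 2`-matrices over `K`. -/
def toMat : TwistedDual σ →+* Matrix (Fin 2) (Fin 2) K where
  toFun x := !![x.re, x.eps; 0, σ x.re]
  map_zero' := by ext i j; fin_cases i <;> fin_cases j <;> simp
  map_one' := by ext i j; fin_cases i <;> fin_cases j <;> simp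
  map_add' x y := by ext i j; fin_cases i <;> fin_cases j <;> simp
  map_mul' x y := by ext i j; fin_cases i <;> fin_cases j <;> simp [Matrix.mul_apply]

/-- The base block `B₀ = ℙ(K)`, as a subset of `ℙ(R)`, where `R = K(ε;σ)`. -/
def baseBlock : Set (ProjLine (TwistedDual σ)) := Set.range (ProjLine.map (ofBase σ))

/-- The blocks of `Σ`: the orbit of the base block `B₀` under `GL₂(R)`, where `R = K(ε;σ)`. -/
def blocks : Set (Set (ProjLine (TwistedDual σ))) :=
  {B | ∃ g : GLTwo (TwistedDual σ), B = ProjLine.act g '' baseBlock σ}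

end TwistedDual

/-! ### The Klein quadric and Hotje's map -/

section Hotje

variable (K : Type*) [Field K]

/-- The ring of `2 × 2`-matrices over `K`. -/
abbrev MatTwo : Type _ := Matrix (Fin 2) (Fin 2) K

/-- The `6`-dimensional vector space over `K` underlying `PG(5,K)`. -/
abbrev KleinSpace : Type _ := MatTwo K × K × K

variable {K}

/-- The coordinate `C i j` of `(C, x, y)`, as a linear form. -/
def kleinEntry (i j : Fin 2) : KleinSpace K →ₗ[K] K where
  toFun v := v.1 i j
  map_add' _ _ := rfl
  map_smul' _ _ := rfl

/-- The coordinate `x` of `(C, x, y)`, as a linear form. -/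
def kleinX : KleinSpace K →ₗ[K] K := LinearMap.fst K K K ∘ₗ LinearMap.snd K (MatTwo K) (K × K)

/-- The coordinate `y` of `(C, x, y)`, as a linear form. -/
def kleinY : KleinSpace K →ₗ[K] K := LinearMap.snd K K K ∘ₗ LinearMap.snd K (MatTwo K) (K × K)

variable (K) in
/-- The quadratic form `(C, x, y) ↦ det C - x y`. -/
def kleinForm : QuadraticForm K (KleinSpace K) :=
  QuadraticMap.linMulLin (kleinEntry 0 0) (kleinEntry 1 1)
    - QuadraticMap.linMulLin (kleinEntry 0 1) (kleinEntry 1 0)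
    - QuadraticMap.linMulLin kleinX kleinY

theorem kleinForm_apply (C : MatTwo K) (x y : K) :
    kleinForm K (C, x, y) = C.det - x * y := by
  rw [Matrix.det_fin_two]
  rfl

/-- The set of points of a projective space that belong to the projective subspace given by a
subspace of the underlying vector space. -/
def pointsOf {V : Type*} [AddCommGroup V] [Module K V] (U : Submodule K V) : Set (ℙ K V) :=
  {p | p.submodule ≤ U}

/-- The cone with vertex `S` over the point set `X`: the union of the lines joining `S` with the
points of `X`. -/
def coneOver {V : Type*} [AddCommGroup V] [Module K V] (S : ℙ K V) (X : Set (ℙ K V)) :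
    Set (ℙ K V) :=
  ⋃ p ∈ X, pointsOf (S.submodule ⊔ p.submodule)

variable (K) in
/-- The Klein quadric in `PG(5,K)`. -/
def kleinQuadric : Set (ℙ K (KleinSpace K)) :=
  {p | ∀ v ∈ p.submodule, kleinForm K v = 0}

/-- For a point `S` of the Klein quadric: the subspace of all vectors conjugate to `S`, i.e. the
tangent hyperplane of the Klein quadric at `S`. -/
noncomputable def tangentHyperplane (S : ℙ K (KleinSpace K)) : Submodule K (KleinSpace K) :=
  LinearMap.ker ((kleinForm K).polarBilin S.rep)

/-- The vector `(B̃ A, det A, det B)` attached to a pair `(A, B)` of matrices, where `B̃` is the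
adjugate of `B`. -/
def hotjeVec (v : Fin 2 → MatTwo K) : KleinSpace K :=
  ((v 1).adjugate * v 0, (v 0).det, (v 1).det)

theorem hotjeVec_smul (C : MatTwo K) (v : Fin 2 → MatTwo K) :
    hotjeVec (C • v) = C.det • hotjeVec v := by
  simp only [hotjeVec, Pi.smul_apply, smul_eq_mul, Matrix.adjugate_mul_distrib, Matrix.det_mul,
    Prod.smul_mk]
  congr 1
  rw [Matrix.mul_assoc, ← Matrix.mul_assoc C.adjugate, Matrix.adjugate_mul]
  simp

theorem hotjeVec_ne_zero (g : GLTwo (MatTwo K)) : hotjeVec (g.val.row 0) ≠ 0 := by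
  intro h
  simp only [hotjeVec, Prod.mk_eq_zero] at h
  obtain ⟨h1, h2, h3⟩ := h
  have hg : g.val.row 0 0 * g⁻¹.val 0 0 + g.val.row 0 1 * g⁻¹.val 1 0 = 1 := by
    have := congrFun (congrFun g.mul_inv 0) 0
    simpa [Matrix.mul_apply, Fin.sum_univ_two] using this
  generalize g.val.row 0 = v at *
  have hB : (v 1).adjugate = 0 := by
    have := congrArg (fun X => (v 1).adjugate * X) hg
    simp only [mul_add, ← mul_assoc, h1, Matrix.adjugate_mul, h3, mul_one] at this
    simpa using this.symm
  have hB' : v 1 = 0 := by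
    have h4 := Matrix.adjugate_adjugate (v 1) (by simp)
    rw [hB] at h4
    simpa using h4.symm
  rw [hB', zero_mul, add_zero] at hg
  have := congrArg Matrix.det hg
  rw [Matrix.det_mul, h2] at this
  simp at this

/-- Hotje's map `Φ : M(A,B) ↦ K(B̃ A, det A, det B)` from the projective line over the ring `M` of
`2 × 2`-matrices over `K` to the points of `PG(5,K)`. It does not depend on the choice of `(A,B)`,
see `hotje_eq`. -/
noncomputable def hotje (p : ProjLine (MatTwo K)) : ℙ K (KleinSpace K) :=
  Projectivization.mk K (hotjeVec (p.2.choose.val.row 0)) (hotjeVec_ne_zero _)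

theorem hotje_eq (p : ProjLine (MatTwo K)) (g : GLTwo (MatTwo K))
    (hp : p.1 = Submodule.span (MatTwo K) {g.val.row 0}) :
    hotje p = Projectivization.mk K (hotjeVec (g.val.row 0)) (hotjeVec_ne_zero g) := by
  have hmem : p.2.choose.val.row 0 ∈ Submodule.span (MatTwo K) {g.val.row 0} := by
    rw [← hp]
    exact p.2.choose_spec.symm.le (Submodule.mem_span_singleton_self _)
  obtain ⟨C, hC⟩ := Submodule.mem_span_singleton.1 hmem
  refine (Projectivization.mk_eq_mk_iff' K _ _ _ _).2 ⟨C.det, ?_⟩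
  rw [← hC, hotjeVec_smul]

end Hotje

/-- The identification of the points of `ℙ(R)`, `R = K(ε;σ)`, with points of `PG(5,K)`: the
embedding of `ℙ(R)` in `ℙ(M)` followed by Hotje's map. -/
noncomputable def kleinModel {K : Type*} [Field K] (σ : K →+* K)
    (p : ProjLine (TwistedDual σ)) : ℙ K (KleinSpace K) :=
  hotje (ProjLine.map (TwistedDual.toMat σ) p)

theorem vertexVec_ne_zero (K : Type*) [Field K] :
    ((!![0, 1; 0, 0], 0, 0) : KleinSpace K) ≠ 0 := by
  intro h
  have := congrFun (congrFun (congrArg Prod.fst h) 0) 1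
  simp at this

/-- The point `S = K(0,1,0,0,0,0)`, where `K(x₁,x₂,x₃,x₄,x₅,x₆)` stands for
`K(!![x₁, x₂; x₃, x₄], x₅, x₆)`. -/
def coneVertex (K : Type*) [Field K] : ℙ K (KleinSpace K) :=
  Projectivization.mk K (!![0, 1; 0, 0], 0, 0) (vertexVec_ne_zero K)

/-- The cone with vertex `S` over the (image of the) base block. -/
noncomputable def blockCone {K : Type*} [Field K] (σ : K →+* K) : Set (ℙ K (KleinSpace K)) :=
  coneOver (coneVertex K) (kleinModel σ '' TwistedDual.baseBlock σ)

/-!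
The theorem follows from explicit coordinates. As `R = K(ε;σ)` is local with maximal ideal `Kε`,
the points of `ℙ(R)` are `R(x + yε, 1)` and `R(1, yε)` (`TwistedDual.point_cases`), those of the
base block being the ones with `y = 0`. Hotje's map sends them to the points spanned by
`(!![x, y; 0, σ x], x * σ x, 1)` and `(!![0, -y; 0, 0], 1, 0)` (`kleinModel_affine`,
`kleinModel_infinite`). Varying `y` thus means moving along a line through the vertex `S`, so that
the image of `ℙ(R)` is the cone over the base block without `S` (`mem_blockCone_iff`). The tangent
hyperplane at `S` has the equation `C₁₀ = 0`.

For the blocks, `GL₂(R) = GL₂(K) ⋉ (1 + M₂(K)ε)`, and `GL₂(K)` leaves the base block invariant.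
Hence the blocks are the images of the base block under the matrices `1 + Nε`
(`TwistedDual.mem_blocks_iff`). Such a matrix sends `R(x, 1)` to the point `R(x + yε, 1)` with
`y = N₀₀ x - N₀₁ x σ(x) + N₁₀ - N₁₁ σ(x)`, and `R(1, 0)` to `R(1, N₀₁ ε)`. These are exactly the
points of the cone in the `3`-space with the equation
`C₀₁ = N₀₀ C₀₀ - N₀₁ x + N₁₀ y - N₁₁ C₁₁` of the tangent hyperplane (`kleinModel_image_block`).
As a complement of `S` in the hyperplane is the graph of `C₀₁` as a linear form in the remaining
four coordinates, each such complement arises in this way (`exists_eq_complementOf`).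
-/

/-! ### Normal forms of the points of a projective line -/

namespace ProjLine

section General

variable {R R' : Type*} [Ring R] [Ring R']

/-- The matrix with first row `(r, 1)` representing the point `R(r, 1)`. -/
def affineMat (r : R) : GLTwo R where
  val := !![r, 1; -1, 0]
  inv := !![0, -1; 1, r]
  val_inv := by ext i j; fin_cases i <;> fin_cases j <;> simp
  inv_val := by ext i j; fin_cases i <;> fin_cases j <;> simp

/-- The matrix with first row `(1, s)` representing the point `R(1, s)`. -/
def infiniteMat (s : R) : GLTwo R where
  val := !![1, s; 0, 1]
  inv := !![1, -s; 0, 1]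
  val_inv := by ext i j; fin_cases i <;> fin_cases j <;> simp
  inv_val := by ext i j; fin_cases i <;> fin_cases j <;> simp

/-- The point `R(r, 1)` of `ℙ(R)`. -/
def affine (r : R) : ProjLine R := ⟨Submodule.span R {![r, 1]}, affineMat r, rfl⟩

/-- The point `R(1, s)` of `ℙ(R)`. It is not of the form `R(r, 1)` if `s` is not a unit. -/
def infinite (s : R) : ProjLine R := ⟨Submodule.span R {![1, s]}, infiniteMat s, rfl⟩

/-- Multiplying a generator from the left by a unit does not change the point. -/
theorem eq_of_unit_smul {p q : ProjLine R} {v w : Fin 2 → R} {u : R} (hu : IsUnit u)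
    (hp : p.1 = Submodule.span R {v}) (hq : q.1 = Submodule.span R {w}) (h : v = u • w) :
    p = q := by
  apply Subtype.ext
  rw [hp, hq, h, Submodule.span_singleton_smul_eq hu]

theorem map_val (f : R →+* R') {p : ProjLine R} {v : Fin 2 → R}
    (hp : p.1 = Submodule.span R {v}) : (map f p).1 = Submodule.span R' {f ∘ v} := by
  change Submodule.span R' ((fun v : Fin 2 → R => f ∘ v) '' (p.1 : Set (Fin 2 → R))) = _
  rw [hp]
  apply le_antisymm
  · rw [Submodule.span_le]
    rintro _ ⟨w, hw, rfl⟩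
    obtain ⟨r, rfl⟩ := Submodule.mem_span_singleton.1 hw
    exact Submodule.mem_span_singleton.2 ⟨f r, by ext i; simp⟩
  · rw [Submodule.span_singleton_le_iff_mem]
    exact Submodule.subset_span ⟨v, Submodule.mem_span_singleton_self _, rfl⟩

theorem act_val (g : GLTwo R) {p : ProjLine R} {v : Fin 2 → R}
    (hp : p.1 = Submodule.span R {v}) :
    (act g p).1 = Submodule.span R {Matrix.vecMul v g.val} := by
  change p.1.map (Matrix.vecMulLinear g.val) = _
  rw [hp, Submodule.map_span, Set.image_singleton]
  rfl

theorem map_affine (f : R →+* R') (r : R) : map f (affine r) = affine (f r) := by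
  refine eq_of_unit_smul isUnit_one (map_val f rfl) rfl ?_
  ext i; fin_cases i <;> simp

theorem map_infinite (f : R →+* R') (s : R) : map f (infinite s) = infinite (f s) := by
  refine eq_of_unit_smul isUnit_one (map_val f rfl) rfl ?_
  ext i; fin_cases i <;> simp

theorem act_mul (g h : GLTwo R) (p : ProjLine R) : act (g * h) p = act h (act g p) := by
  obtain ⟨k, hk⟩ := p.2
  refine eq_of_unit_smul isUnit_one (act_val _ hk) (act_val _ (act_val _ hk)) ?_
  simp [Matrix.vecMul_vecMul]

theorem act_one (p : ProjLine R) : act 1 p = p := by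
  obtain ⟨k, hk⟩ := p.2
  refine eq_of_unit_smul isUnit_one (act_val _ hk) hk ?_
  simp

/-- The map of projective lines induced by `f : R → R'` is equivariant with respect to the
homomorphism `GL₂(R) → GL₂(R')` induced by `f`. -/
theorem act_map (f : R →+* R') (g : GLTwo R) (p : ProjLine R) :
    act (Units.map (f.mapMatrix : Matrix (Fin 2) (Fin 2) R →+* _).toMonoidHom g) (map f p) =
      map f (act g p) := by
  obtain ⟨k, hk⟩ := p.2
  refine eq_of_unit_smul isUnit_one (act_val _ (map_val _ hk)) (map_val _ (act_val _ hk)) ?_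
  rw [one_smul]
  funext i
  exact (RingHom.map_vecMul f g.val (k.val.row 0) i).symm

/-- The hypothesis, which holds for local rings, says that one of the entries of a generator of a
point is a unit. This entry can be scaled to `1`. -/
theorem eq_affine_or_eq_infinite (p : ProjLine R)
    (h : ∀ a b c d : R, a * c + b * d = 1 → IsUnit a ∨ IsUnit b) :
    (∃ r, p = affine r) ∨ ∃ s, ¬ IsUnit s ∧ p = infinite s := by
  obtain ⟨g, hg⟩ := p.2
  have h1 : g.val 0 0 * g⁻¹.val 0 0 + g.val 0 1 * g⁻¹.val 1 0 = 1 := by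
    have := congrFun (congrFun g.mul_inv 0) 0
    simpa [Matrix.mul_apply, Fin.sum_univ_two] using this
  by_cases hb : IsUnit (g.val 0 1)
  · obtain ⟨u, hu⟩ := hb
    refine Or.inl ⟨u⁻¹ * g.val 0 0, eq_of_unit_smul u.isUnit hg rfl ?_⟩
    ext i; fin_cases i <;> simp [← hu]
  · obtain ⟨u, hu⟩ := (h _ _ _ _ h1).resolve_right hb
    refine Or.inr ⟨u⁻¹ * g.val 0 1, ?_, eq_of_unit_smul u.isUnit hg rfl ?_⟩
    · rwa [Units.isUnit_units_mul]
    · ext i; fin_cases i <;> simp [← hu]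

end General

end ProjLine

namespace TwistedDual

variable {K : Type*} [Field K] {σ : K →+* K}

theorem isUnit_iff {r : TwistedDual σ} : IsUnit r ↔ r.re ≠ 0 := by
  constructor
  · rintro ⟨u, rfl⟩ h
    have := congrArg TwistedDual.re u.mul_inv
    rw [mul_re, h, zero_mul] at this
    exact zero_ne_one this
  · intro h
    have h' : σ r.re ≠ 0 := (map_ne_zero σ).2 h
    refine ⟨⟨r, ⟨r.re⁻¹, -(r.re⁻¹ * r.eps * (σ r.re)⁻¹)⟩, ?_, ?_⟩, rfl⟩
    · ext <;> simp [h]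
      field_simp
      ring
    · ext <;> simp [h, h']

/-- The points of the projective line over `K(ε;σ)` are `R(x + yε, 1)` and `R(1, yε)`. -/
theorem point_cases (p : ProjLine (TwistedDual σ)) :
    (∃ x y, p = ProjLine.affine ⟨x, y⟩) ∨ ∃ y, p = ProjLine.infinite ⟨0, y⟩ := by
  have hlocal (a b c d : TwistedDual σ) (h : a * c + b * d = 1) : IsUnit a ∨ IsUnit b := by
    simp only [isUnit_iff]
    by_contra! h'
    have := congrArg TwistedDual.re h
    simp [h'.1, h'.2] at this
  rcases p.eq_affine_or_eq_infinite hlocal with ⟨⟨x, y⟩, h⟩ | ⟨⟨x, y⟩, hx, h⟩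
  · exact Or.inl ⟨x, y, h⟩
  · obtain rfl : x = 0 := by simpa [isUnit_iff] using hx
    exact Or.inr ⟨y, h⟩

/-- The points of the base block are `R(x, 1)` with `x ∈ K` and `R(1, 0)`. -/
theorem mem_baseBlock_iff {p : ProjLine (TwistedDual σ)} :
    p ∈ baseBlock σ ↔ (∃ x, p = ProjLine.affine ⟨x, 0⟩) ∨ p = ProjLine.infinite 0 := by
  constructor
  · rintro ⟨p, rfl⟩
    have hlocal (a b c d : K) (h : a * c + b * d = 1) : IsUnit a ∨ IsUnit b := by
      simp only [isUnit_iff_ne_zero]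
      by_contra! h'
      simp [h'.1, h'.2] at h
    rcases p.eq_affine_or_eq_infinite hlocal with ⟨x, rfl⟩ | ⟨x, hx, rfl⟩
    · exact Or.inl ⟨x, ProjLine.map_affine _ _⟩
    · obtain rfl : x = 0 := by simpa using hx
      exact Or.inr (by rw [ProjLine.map_infinite, map_zero])
  · rintro (⟨x, rfl⟩ | rfl)
    · exact ⟨_, ProjLine.map_affine _ x⟩
    · exact ⟨ProjLine.infinite 0, by rw [ProjLine.map_infinite, map_zero]⟩

/-! ### The blocks as images of the base block under a unipotent group -/

variable (σ) in
/-- The projection `a + bε ↦ a` of `K(ε;σ)` onto its residue field `K`. -/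
def reHom : TwistedDual σ →+* K where
  toFun := TwistedDual.re
  map_zero' := rfl
  map_one' := rfl
  map_add' _ _ := rfl
  map_mul' _ _ := rfl

variable (σ) in
/-- The matrix `1 + Nε`, where `N` is a matrix over `K`. -/
def unipotent (N : Matrix (Fin 2) (Fin 2) K) : GLTwo (TwistedDual σ) where
  val := 1 + N.map fun a => ⟨0, a⟩
  inv := 1 + N.map fun a => ⟨0, -a⟩
  val_inv := by
    ext i j <;> fin_cases i <;> fin_cases j <;> simp [Matrix.mul_apply, Fin.sum_univ_two]
  inv_val := by
    ext i j <;> fin_cases i <;> fin_cases j <;> simp [Matrix.mul_apply, Fin.sum_univ_two]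

/-- `GL₂(R) = GL₂(K) ⋉ (1 + M₂(K)ε)`. -/
theorem exists_eq_map_mul_unipotent (g : GLTwo (TwistedDual σ)) :
    ∃ (h : GLTwo K) (N : Matrix (Fin 2) (Fin 2) K),
      g = Units.map ((ofBase σ).mapMatrix : Matrix (Fin 2) (Fin 2) K →+* _).toMonoidHom h *
        unipotent σ N := by
  set h : GLTwo K :=
    Units.map ((reHom σ).mapMatrix : Matrix (Fin 2) (Fin 2) _ →+* _).toMonoidHom g with hh
  set L : Matrix (Fin 2) (Fin 2) K := g.val.map TwistedDual.eps with hL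
  refine ⟨h, h⁻¹.val * L, Units.ext ?_⟩
  have key : h.val * (h⁻¹.val * L) = L := by rw [← Matrix.mul_assoc]; simp
  have hre : ∀ i j, h.val i j = (g.val i j).re := fun i j => rfl
  generalize h⁻¹.val * L = N at *
  ext i j
  · rw [← hre]
    fin_cases i <;> fin_cases j <;>
      simp [unipotent, ofBase, Matrix.mul_apply, Fin.sum_univ_two]
  · have := congrFun (congrFun key i) j
    change (g.val i j).eps = _
    rw [show (g.val i j).eps = L i j from rfl, ← this]
    fin_cases i <;> fin_cases j <;>
      simp [unipotent, ofBase, Matrix.mul_apply, Fin.sum_univ_two]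

/-- `GL₂(K)` leaves the base block invariant. -/
theorem act_map_image_baseBlock (h : GLTwo K) :
    ProjLine.act (Units.map ((ofBase σ).mapMatrix : Matrix (Fin 2) (Fin 2) K →+* _).toMonoidHom h)
      '' baseBlock σ = baseBlock σ := by
  ext q
  constructor
  · rintro ⟨_, ⟨p, rfl⟩, rfl⟩
    exact ⟨ProjLine.act h p, (ProjLine.act_map _ _ _).symm⟩
  · rintro ⟨p, rfl⟩
    refine ⟨_, ⟨ProjLine.act h⁻¹ p, rfl⟩, ?_⟩
    rw [ProjLine.act_map, ← ProjLine.act_mul, inv_mul_cancel, ProjLine.act_one]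

theorem mem_blocks_iff {B : Set (ProjLine (TwistedDual σ))} :
    B ∈ blocks σ ↔ ∃ N, B = ProjLine.act (unipotent σ N) '' baseBlock σ := by
  constructor
  · rintro ⟨g, rfl⟩
    obtain ⟨h, N, rfl⟩ := exists_eq_map_mul_unipotent g
    refine ⟨N, ?_⟩
    conv_rhs => rw [← act_map_image_baseBlock h, Set.image_image]
    simp only [ProjLine.act_mul]
  · rintro ⟨N, rfl⟩
    exact ⟨_, rfl⟩

theorem act_unipotent_affine (N : Matrix (Fin 2) (Fin 2) K) (x : K) :
    ProjLine.act (unipotent σ N) (ProjLine.affine ⟨x, 0⟩) =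
      ProjLine.affine ⟨x, N 0 0 * x - N 0 1 * (x * σ x) + N 1 0 - N 1 1 * σ x⟩ := by
  -- The unit is the second entry `1 + (x N₀₁ + N₁₁)ε` of `(x, 1) (1 + Nε)`.
  refine ProjLine.eq_of_unit_smul (u := ⟨1, x * N 0 1 + N 1 1⟩) (isUnit_iff.2 one_ne_zero)
    (ProjLine.act_val _ rfl) rfl ?_
  ext i <;> fin_cases i <;> simp [Matrix.vecMul, dotProduct, Fin.sum_univ_two, unipotent]
  ring

theorem act_unipotent_infinite (N : Matrix (Fin 2) (Fin 2) K) :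
    ProjLine.act (unipotent σ N) (ProjLine.infinite 0) = ProjLine.infinite ⟨0, N 0 1⟩ := by
  refine ProjLine.eq_of_unit_smul (u := ⟨1, N 0 0⟩) (isUnit_iff.2 one_ne_zero)
    (ProjLine.act_val _ rfl) rfl ?_
  ext i <;> fin_cases i <;> simp [Matrix.vecMul, dotProduct, Fin.sum_univ_two, unipotent]

end TwistedDual

/-! ### Points of the Klein quadric -/

@[ext]
theorem kleinSpace_ext {K : Type*} {v w : KleinSpace K} (h00 : v.1 0 0 = w.1 0 0)
    (h01 : v.1 0 1 = w.1 0 1)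
    (h10 : v.1 1 0 = w.1 1 0) (h11 : v.1 1 1 = w.1 1 1) (hx : v.2.1 = w.2.1)
    (hy : v.2.2 = w.2.2) : v = w := by
  refine Prod.ext ?_ (Prod.ext hx hy)
  ext i j
  fin_cases i <;> fin_cases j <;> assumption

section Klein

variable {K : Type*} [Field K]

theorem mk_mem_pointsOf {V : Type*} [AddCommGroup V] [Module K V] {U : Submodule K V} {v : V}
    {hv : v ≠ 0} : Projectivization.mk K v hv ∈ pointsOf U ↔ v ∈ U := by
  simp [pointsOf, Projectivization.submodule_mk]

/-- The line joining the points `K s` and `K p` consists of `K s` and the points `K (p + t s)`. -/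
theorem mem_pointsOf_sup_iff {V : Type*} [AddCommGroup V] [Module K V] {s p : V} {hs : s ≠ 0}
    {hp : p ≠ 0} (q : ℙ K V) :
    q ∈ pointsOf ((Projectivization.mk K s hs).submodule ⊔ (Projectivization.mk K p hp).submodule) ↔
      q = Projectivization.mk K s hs ∨
        ∃ (t : K) (h : p + t • s ≠ 0), q = Projectivization.mk K (p + t • s) h := by
  induction q using Projectivization.ind with | _ v hv => ?_
  simp only [mk_mem_pointsOf, Projectivization.submodule_mk, ← Submodule.span_insert,
    Submodule.mem_span_pair, Projectivization.mk_eq_mk_iff']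
  constructor
  · rintro ⟨a, b, rfl⟩
    by_cases hb : b = 0
    · exact Or.inl ⟨a, by simp [hb]⟩
    · have h : b • (p + (b⁻¹ * a) • s) = a • s + b • p := by
        rw [smul_add, smul_smul, mul_inv_cancel_left₀ hb, add_comm]
      refine Or.inr ⟨b⁻¹ * a, fun h0 => hv ?_, b, h⟩
      rw [← h, h0, smul_zero]
  · rintro (⟨a, rfl⟩ | ⟨t, -, a, rfl⟩)
    · exact ⟨a, 0, by simp⟩
    · exact ⟨a * t, a, by rw [smul_add, smul_smul, add_comm]⟩

theorem mk_mem_kleinQuadric {v : KleinSpace K} {hv : v ≠ 0} :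
    Projectivization.mk K v hv ∈ kleinQuadric K ↔ kleinForm K v = 0 := by
  simp only [kleinQuadric, Set.mem_ofPred_eq, Projectivization.submodule_mk]
  refine ⟨fun h => h v (Submodule.mem_span_singleton_self v), fun h w hw => ?_⟩
  obtain ⟨a, rfl⟩ := Submodule.mem_span_singleton.1 hw
  rw [QuadraticMap.map_smul, h, smul_zero]

theorem mem_tangentHyperplane_coneVertex {v : KleinSpace K} :
    v ∈ tangentHyperplane (coneVertex K) ↔ v.1 1 0 = 0 := by
  obtain ⟨a, ha⟩ := (Projectivization.mk_eq_mk_iff' K _ _ (coneVertex K).rep_nonzero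
    (vertexVec_ne_zero K)).1 (coneVertex K).mk_rep
  have ha0 : a ≠ 0 := by
    rintro rfl
    exact (coneVertex K).rep_nonzero (by rw [← ha, zero_smul])
  obtain ⟨C, x, y⟩ := v
  rw [tangentHyperplane, LinearMap.mem_ker, ← ha, map_smul, LinearMap.smul_apply,
    smul_eq_zero_iff_right ha0, QuadraticMap.polarBilin_apply_apply, QuadraticMap.polar]
  simp only [Prod.mk_add_mk, kleinForm_apply, Matrix.det_fin_two]
  simp
  ring_nf
  simp

theorem finrank_tangentHyperplane_coneVertex :
    Module.finrank K (tangentHyperplane (coneVertex K)) = 5 := by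
  have h : tangentHyperplane (coneVertex K) = LinearMap.ker (kleinEntry (K := K) 1 0) :=
    Submodule.ext fun v => mem_tangentHyperplane_coneVertex
  have h0 : kleinEntry (K := K) 1 0 ≠ 0 := fun h0 => by
    have := LinearMap.congr_fun h0 (!![0, 0; 1, 0], 0, 0)
    exact one_ne_zero (this : (1 : K) = 0)
  have h6 : Module.finrank K (KleinSpace K) = 6 := by simp [Module.finrank_matrix]
  have := Module.Dual.finrank_ker_add_one_of_ne_zero h0
  rw [h]
  omega

/-! ### The solids of the tangent hyperplane that miss the vertex -/

/-- The linear form on the Klein space whose kernel meets the tangent hyperplane at the vertex in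
`complementOf N`. -/
def complementForm (N : Matrix (Fin 2) (Fin 2) K) : KleinSpace K →ₗ[K] K :=
  kleinEntry 0 1 - (N 0 0 • kleinEntry 0 0 - N 0 1 • kleinX + N 1 0 • kleinY
    - N 1 1 • kleinEntry 1 1)

/-- The complement of the vertex in its tangent hyperplane given by the equation
`C₀₁ = N₀₀ C₀₀ - N₀₁ x + N₁₀ y - N₁₁ C₁₁`. The signs and the order of the coefficients are such
that it contains the image of the base block under `1 + Nε`. -/
def complementOf (N : Matrix (Fin 2) (Fin 2) K) : Submodule K (KleinSpace K) :=
  LinearMap.ker (kleinEntry 1 0) ⊓ LinearMap.ker (complementForm N)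

theorem mem_complementOf {N : Matrix (Fin 2) (Fin 2) K} {v : KleinSpace K} :
    v ∈ complementOf N ↔ v.1 1 0 = 0 ∧
      v.1 0 1 = N 0 0 * v.1 0 0 - N 0 1 * v.2.1 + N 1 0 * v.2.2 - N 1 1 * v.1 1 1 := by
  rw [complementOf, Submodule.mem_inf, LinearMap.mem_ker, LinearMap.mem_ker,
    ← sub_eq_zero (b := _ - _)]
  rfl

theorem complementOf_le (N : Matrix (Fin 2) (Fin 2) K) :
    complementOf N ≤ tangentHyperplane (coneVertex K) := fun _ hv =>
  mem_tangentHyperplane_coneVertex.2 (mem_complementOf.1 hv).1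

theorem mem_coneVertex_submodule {v : KleinSpace K} :
    v ∈ (coneVertex K).submodule ↔ ∃ t : K, v = (!![0, t; 0, 0], 0, 0) := by
  rw [coneVertex, Projectivization.submodule_mk, Submodule.mem_span_singleton]
  simp only [Prod.smul_mk, Matrix.smul_of, Matrix.smul_cons, smul_eq_mul, mul_zero, mul_one,
    Matrix.smul_empty, eq_comm]

theorem coneVertex_inf_complementOf (N : Matrix (Fin 2) (Fin 2) K) :
    (coneVertex K).submodule ⊓ complementOf N = ⊥ := by
  rw [eq_bot_iff]
  rintro v ⟨hv, hN⟩
  obtain ⟨t, rfl⟩ := mem_coneVertex_submodule.1 hv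
  have := (mem_complementOf.1 hN).2
  obtain rfl : t = 0 := by simpa using this
  rw [Submodule.mem_bot]
  ext <;> simp

theorem coneVertex_sup_complementOf (N : Matrix (Fin 2) (Fin 2) K) :
    (coneVertex K).submodule ⊔ complementOf N = tangentHyperplane (coneVertex K) := by
  apply le_antisymm
  · refine sup_le (fun v hv => ?_) (complementOf_le N)
    obtain ⟨t, rfl⟩ := mem_coneVertex_submodule.1 hv
    simp [mem_tangentHyperplane_coneVertex]
  · intro v hv
    rw [mem_tangentHyperplane_coneVertex] at hv
    set t : K := N 0 0 * v.1 0 0 - N 0 1 * v.2.1 + N 1 0 * v.2.2 - N 1 1 * v.1 1 1 with ht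
    refine Submodule.mem_sup.2 ⟨(!![0, v.1 0 1 - t; 0, 0], 0, 0),
      mem_coneVertex_submodule.2 ⟨_, rfl⟩,
      (!![v.1 0 0, t; 0, v.1 1 1], v.2.1, v.2.2), ?_, ?_⟩
    · rw [mem_complementOf]
      simp [ht]
    · ext <;> simp [hv]

theorem finrank_complementOf (N : Matrix (Fin 2) (Fin 2) K) :
    Module.finrank K (complementOf N) = 4 := by
  have := Submodule.finrank_sup_add_finrank_inf_eq (coneVertex K).submodule (complementOf N)
  rw [coneVertex_sup_complementOf, coneVertex_inf_complementOf,
    finrank_tangentHyperplane_coneVertex, Projectivization.finrank_submodule, finrank_bot] at this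
  omega

/-- Every complement of the vertex in its tangent hyperplane is the graph of `C₀₁` as a linear
form in the remaining coordinates. -/
theorem exists_eq_complementOf {U : Submodule K (KleinSpace K)}
    (hinf : (coneVertex K).submodule ⊓ U = ⊥)
    (hsup : (coneVertex K).submodule ⊔ U = tangentHyperplane (coneVertex K)) :
    ∃ N, U = complementOf N := by
  have hgraph (a d x y : K) : ∃ b, ((!![a, b; 0, d], x, y) : KleinSpace K) ∈ U := by
    have hmem : ((!![a, 0; 0, d], x, y) : KleinSpace K) ∈ (coneVertex K).submodule ⊔ U := by
      rw [hsup, mem_tangentHyperplane_coneVertex]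
      simp
    obtain ⟨s, hs, u, hu, hsu⟩ := Submodule.mem_sup.1 hmem
    obtain ⟨t, rfl⟩ := mem_coneVertex_submodule.1 hs
    refine ⟨-t, ?_⟩
    have hu' : u = (!![a, -t; 0, d], x, y) := by
      rw [← sub_eq_iff_eq_add'.2 hsu.symm]
      ext <;> simp
    rwa [← hu']
  obtain ⟨n00, h00⟩ := hgraph 1 0 0 0
  obtain ⟨n11, h11⟩ := hgraph 0 1 0 0
  obtain ⟨n01, h01⟩ := hgraph 0 0 1 0
  obtain ⟨n10, h10⟩ := hgraph 0 0 0 1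
  have hle : complementOf !![n00, -n01; n10, -n11] ≤ U := by
    intro v hv
    obtain ⟨hv0, hv1⟩ := mem_complementOf.1 hv
    have := U.add_mem (U.add_mem (U.smul_mem (v.1 0 0) h00) (U.smul_mem (v.1 1 1) h11))
      (U.add_mem (U.smul_mem v.2.1 h01) (U.smul_mem v.2.2 h10))
    convert this
    ext <;> simp [hv0, hv1]
    ring
  -- Comparable complements are equal by the modular law.
  refine ⟨_, (le_antisymm hle ?_).symm⟩
  have hU : U ≤ (coneVertex K).submodule ⊔ complementOf !![n00, -n01; n10, -n11] := by
    rw [coneVertex_sup_complementOf, ← hsup]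
    exact le_sup_right
  exact (eq_of_le_of_inf_le_of_sup_le (z := (coneVertex K).submodule) hle
    (by rw [inf_comm, hinf]; exact bot_le) (sup_le (by rwa [sup_comm]) le_sup_right)).ge

end Klein

/-! ### The model of the projective line on the Klein quadric -/

section Model

variable {K : Type*} [Field K]

/-- The vector representing the image of the point `R(x + yε, 1)` on the Klein quadric. -/
def affineVec (σ : K →+* K) (x y : K) : KleinSpace K := (!![x, y; 0, σ x], x * σ x, 1)

/-- The vector representing the image of the point `R(1, -yε)` on the Klein quadric. -/
def infiniteVec (y : K) : KleinSpace K := (!![0, y; 0, 0], 1, 0)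

theorem affineVec_ne_zero (σ : K →+* K) (x y : K) : affineVec σ x y ≠ 0 := fun h =>
  one_ne_zero (congrArg (fun v : KleinSpace K => v.2.2) h)

theorem infiniteVec_ne_zero (y : K) : infiniteVec y ≠ 0 := fun h =>
  one_ne_zero (congrArg (fun v : KleinSpace K => v.2.1) h)

theorem kleinModel_affine (σ : K →+* K) (x y : K) :
    kleinModel σ (ProjLine.affine ⟨x, y⟩) =
      Projectivization.mk K (affineVec σ x y) (affineVec_ne_zero σ x y) := by
  rw [kleinModel, ProjLine.map_affine, hotje_eq _ (ProjLine.affineMat _) rfl]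
  congr 1
  ext <;> simp [hotjeVec, ProjLine.affineMat, affineVec, TwistedDual.toMat]

theorem kleinModel_infinite (σ : K →+* K) (y : K) :
    kleinModel σ (ProjLine.infinite ⟨0, y⟩) =
      Projectivization.mk K (infiniteVec (-y)) (infiniteVec_ne_zero _) := by
  rw [kleinModel, ProjLine.map_infinite, hotje_eq _ (ProjLine.infiniteMat _) rfl]
  congr 1
  ext <;> simp [hotjeVec, ProjLine.infiniteMat, infiniteVec, TwistedDual.toMat,
    Matrix.adjugate_fin_two]

theorem kleinModel_injective (σ : K →+* K) : Function.Injective (kleinModel σ) := by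
  intro p q h
  rcases TwistedDual.point_cases p with ⟨x, y, rfl⟩ | ⟨y, rfl⟩ <;>
  rcases TwistedDual.point_cases q with ⟨x', y', rfl⟩ | ⟨y', rfl⟩ <;>
  simp only [kleinModel_affine, kleinModel_infinite] at h <;>
  obtain ⟨a, ha⟩ := (Projectivization.mk_eq_mk_iff' K _ _ _ _).1 h <;>
  have h00 := congrArg (fun v : KleinSpace K => v.1 0 0) ha <;>
  have h01 := congrArg (fun v : KleinSpace K => v.1 0 1) ha <;>
  have hx := congrArg (fun v : KleinSpace K => v.2.1) ha <;>
  have hy := congrArg (fun v : KleinSpace K => v.2.2) ha <;>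
  simp [affineVec, infiniteVec] at h00 h01 hx hy
  · subst hy
    simp_all
  · subst hy
    simp at hx
  · subst hx
    simp_all

theorem range_kleinModel_subset (σ : K →+* K) : Set.range (kleinModel σ) ⊆ kleinQuadric K := by
  rintro _ ⟨p, rfl⟩
  rcases TwistedDual.point_cases p with ⟨x, y, rfl⟩ | ⟨y, rfl⟩
  · rw [kleinModel_affine, mk_mem_kleinQuadric, affineVec, kleinForm_apply, Matrix.det_fin_two]
    simp
  · rw [kleinModel_infinite, mk_mem_kleinQuadric, infiniteVec, kleinForm_apply,
      Matrix.det_fin_two]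
    simp

theorem coneVertex_mem_kleinQuadric : coneVertex K ∈ kleinQuadric K := by
  rw [coneVertex, mk_mem_kleinQuadric, kleinForm_apply, Matrix.det_fin_two]
  simp

theorem coneVertex_notMem_range (σ : K →+* K) : coneVertex K ∉ Set.range (kleinModel σ) := by
  rintro ⟨p, h⟩
  rcases TwistedDual.point_cases p with ⟨x, y, rfl⟩ | ⟨y, rfl⟩
  · rw [kleinModel_affine, coneVertex, Projectivization.mk_eq_mk_iff'] at h
    obtain ⟨a, ha⟩ := h
    simpa [affineVec] using congrArg (fun v : KleinSpace K => v.2.2) ha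
  · rw [kleinModel_infinite, coneVertex, Projectivization.mk_eq_mk_iff'] at h
    obtain ⟨a, ha⟩ := h
    simpa [infiniteVec] using congrArg (fun v : KleinSpace K => v.2.1) ha

/-- The line joining the vertex with the image of `R(x, 1)` carries, besides the vertex, the images
of the points `R(x + yε, 1)`; likewise, the line on the image of `R(1, 0)` carries the images of
the points `R(1, yε)`. -/
theorem mem_blockCone_iff (σ : K →+* K) (q : ℙ K (KleinSpace K)) :
    q ∈ blockCone σ ↔ q = coneVertex K ∨ q ∈ Set.range (kleinModel σ) := by
  have hadd (x y y' : K) :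
      affineVec σ x y + y' • (!![0, 1; 0, 0], 0, 0) = affineVec σ x (y + y') := by
    ext <;> simp [affineVec]
  have hadd' (y y' : K) :
      infiniteVec y + y' • (!![0, 1; 0, 0], 0, 0) = infiniteVec (y + y') := by
    ext <;> simp [infiniteVec]
  have h0 : ProjLine.infinite 0 = ProjLine.infinite (⟨0, 0⟩ : TwistedDual σ) := rfl
  simp only [blockCone, coneOver, Set.mem_iUnion, exists_prop]
  constructor
  · rintro ⟨_, ⟨p, hp, rfl⟩, hq⟩
    rcases TwistedDual.mem_baseBlock_iff.1 hp with ⟨x, rfl⟩ | rfl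
    · rw [kleinModel_affine] at hq
      rcases (mem_pointsOf_sup_iff q).1 hq with h | ⟨t, ht, rfl⟩
      · exact Or.inl h
      · refine Or.inr ⟨ProjLine.affine ⟨x, 0 + t⟩, ?_⟩
        simp only [kleinModel_affine, hadd]
    · rw [h0, kleinModel_infinite] at hq
      rcases (mem_pointsOf_sup_iff q).1 hq with h | ⟨t, ht, rfl⟩
      · exact Or.inl h
      · refine Or.inr ⟨ProjLine.infinite ⟨0, -(-0 + t)⟩, ?_⟩
        simp only [kleinModel_infinite, hadd', neg_neg]
  · rintro (rfl | ⟨p, rfl⟩)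
    · exact ⟨_, ⟨_, TwistedDual.mem_baseBlock_iff.2 (Or.inr rfl), rfl⟩,
        le_sup_left (a := (coneVertex K).submodule)⟩
    · rcases TwistedDual.point_cases p with ⟨x, y, rfl⟩ | ⟨y, rfl⟩
      · refine ⟨_, ⟨_, TwistedDual.mem_baseBlock_iff.2 (Or.inl ⟨x, rfl⟩), rfl⟩, ?_⟩
        rw [kleinModel_affine, kleinModel_affine]
        refine (mem_pointsOf_sup_iff _).2 (Or.inr ⟨y, ?_, ?_⟩)
        · rw [hadd]
          exact affineVec_ne_zero _ _ _
        · simp only [hadd, zero_add]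
      · refine ⟨_, ⟨_, TwistedDual.mem_baseBlock_iff.2 (Or.inr rfl), rfl⟩, ?_⟩
        rw [h0, kleinModel_infinite, kleinModel_infinite]
        refine (mem_pointsOf_sup_iff _).2 (Or.inr ⟨-y, ?_, ?_⟩)
        · rw [hadd']
          exact infiniteVec_ne_zero _
        · simp only [hadd', neg_zero, zero_add]

theorem range_kleinModel_eq (σ : K →+* K) :
    Set.range (kleinModel σ) = blockCone σ \ {coneVertex K} := by
  ext q
  rw [Set.mem_sdiff, mem_blockCone_iff, Set.mem_singleton_iff]
  refine ⟨fun h => ⟨Or.inr h, ?_⟩, fun h => h.1.resolve_left h.2⟩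
  rintro rfl
  exact coneVertex_notMem_range σ h

theorem blockCone_subset (σ : K →+* K) :
    blockCone σ ⊆ pointsOf (tangentHyperplane (coneVertex K)) := by
  intro q hq
  rcases (mem_blockCone_iff σ q).1 hq with rfl | ⟨p, rfl⟩
  · rw [coneVertex, mk_mem_pointsOf, ← coneVertex, mem_tangentHyperplane_coneVertex]
    simp
  · rcases TwistedDual.point_cases p with ⟨x, y, rfl⟩ | ⟨y, rfl⟩
    · rw [kleinModel_affine, mk_mem_pointsOf, mem_tangentHyperplane_coneVertex]
      simp [affineVec]
    · rw [kleinModel_infinite, mk_mem_pointsOf, mem_tangentHyperplane_coneVertex]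
      simp [infiniteVec]

theorem coneVertex_notMem_pointsOf {U : Submodule K (KleinSpace K)}
    (hU : (coneVertex K).submodule ⊓ U = ⊥) : coneVertex K ∉ pointsOf U := fun h => by
  have := (coneVertex K).finrank_submodule
  rw [← inf_eq_left.2 (show (coneVertex K).submodule ≤ U from h), hU, finrank_bot] at this
  exact zero_ne_one this

/-- The block `B₀ (1 + Nε)` corresponds to the section of the cone by `complementOf N`. -/
theorem kleinModel_image_block (σ : K →+* K) (N : Matrix (Fin 2) (Fin 2) K) :
    kleinModel σ '' (ProjLine.act (TwistedDual.unipotent σ N) '' TwistedDual.baseBlock σ) =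
      blockCone σ ∩ pointsOf (complementOf N) := by
  ext q
  constructor
  · rintro ⟨_, ⟨p, hp, rfl⟩, rfl⟩
    refine ⟨(mem_blockCone_iff σ _).2 (Or.inr ⟨_, rfl⟩), ?_⟩
    rcases TwistedDual.mem_baseBlock_iff.1 hp with ⟨x, rfl⟩ | rfl
    · rw [TwistedDual.act_unipotent_affine, kleinModel_affine, mk_mem_pointsOf, mem_complementOf]
      simp [affineVec]
    · rw [TwistedDual.act_unipotent_infinite, kleinModel_infinite, mk_mem_pointsOf,
        mem_complementOf]
      simp [infiniteVec]
  · rintro ⟨hq, hN⟩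
    rcases (mem_blockCone_iff σ q).1 hq with rfl | ⟨p, rfl⟩
    · exact absurd hN (coneVertex_notMem_pointsOf (coneVertex_inf_complementOf N))
    · refine ⟨p, ?_, rfl⟩
      rcases TwistedDual.point_cases p with ⟨x, y, rfl⟩ | ⟨y, rfl⟩
      · rw [kleinModel_affine, mk_mem_pointsOf, mem_complementOf] at hN
        obtain rfl : y = N 0 0 * x - N 0 1 * (x * σ x) + N 1 0 - N 1 1 * σ x := by
          simpa [affineVec] using hN.2
        exact ⟨_, TwistedDual.mem_baseBlock_iff.2 (Or.inl ⟨x, rfl⟩),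
          TwistedDual.act_unipotent_affine N x⟩
      · rw [kleinModel_infinite, mk_mem_pointsOf, mem_complementOf] at hN
        obtain rfl : y = N 0 1 := by simpa [infiniteVec] using hN.2
        exact ⟨_, TwistedDual.mem_baseBlock_iff.2 (Or.inr rfl),
          TwistedDual.act_unipotent_infinite N⟩

end Model

theorem mainTheorem5 {K : Type*} [Field K] [Finite K] (σ : K →+* K) (hσ : σ ≠ RingHom.id K) :
    -- the identification of `ℙ(R)` with its image, a set of points of the Klein quadric
    Function.Injective (kleinModel σ) ∧
    Set.range (kleinModel σ) ⊆ kleinQuadric K ∧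
    -- the image of `ℙ(R)` is the cone over the base block without its vertex
    coneVertex K ∈ kleinQuadric K ∧
    coneVertex K ∉ kleinModel σ '' TwistedDual.baseBlock σ ∧
    Set.range (kleinModel σ) = blockCone σ \ {coneVertex K} ∧
    -- the cone lies in the tangent hyperplane at its vertex, which is a `PG(4,q)`
    Module.finrank K (tangentHyperplane (coneVertex K)) = 5 ∧
    blockCone σ ⊆ pointsOf (tangentHyperplane (coneVertex K)) ∧
    -- the blocks are the intersections of the cone with the complements of the vertex
    (fun B => kleinModel σ '' B) '' TwistedDual.blocks σ =
      {X | ∃ U : Submodule K (KleinSpace K),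
        Module.finrank K U = 4 ∧ U ≤ tangentHyperplane (coneVertex K) ∧
        (coneVertex K).submodule ⊓ U = ⊥ ∧
        (coneVertex K).submodule ⊔ U = tangentHyperplane (coneVertex K) ∧
        X = blockCone σ ∩ pointsOf U} := by
  refine ⟨kleinModel_injective σ, range_kleinModel_subset σ, coneVertex_mem_kleinQuadric,
    fun h => coneVertex_notMem_range σ (Set.image_subset_range _ _ h), range_kleinModel_eq σ,
    finrank_tangentHyperplane_coneVertex, blockCone_subset σ, ?_⟩
  ext X
  constructor
  · rintro ⟨B, hB, rfl⟩
    obtain ⟨N, rfl⟩ := TwistedDual.mem_blocks_iff.1 hB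
    exact ⟨complementOf N, finrank_complementOf N, complementOf_le N,
      coneVertex_inf_complementOf N, coneVertex_sup_complementOf N, kleinModel_image_block σ N⟩
  · rintro ⟨U, -, -, hinf, hsup, rfl⟩
    obtain ⟨N, rfl⟩ := exists_eq_complementOf hinf hsup
    exact ⟨_, TwistedDual.mem_blocks_iff.2 ⟨N, rfl⟩, kleinModel_image_block σ N⟩
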